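/- Let $p$ be a prime, $q = p^a$ with $a \ge 1$, $r \ge 1$ an integer, and let $\sigma : \mathbb{F}_{q^r} \to \mathbb{F}_{q^r}$ be $x \mapsto x^q$. Let $\mathbb{F}_{q^r}[X,\sigma]$ be the skew polynomial ring, i.e. the polynomials $\sum_i a_i X^i$ with the usual addition and the multiplication determined by $X \cdot c = \sigma(c) X$ for $c \in \mathbb{F}_{q^r}$. Say that $A$ is a right-divisor of $B$, and $B$ a left-multiple of $A$, if $B = CA$ for some $C$; a right-greatest common divisor of $A$ and $B$ is a common right-divisor that is a left-multiple of every common right-divisor, and a left-lowest common multiple of $A$ and $B$ is a common left-multiple that is a right-divisor of every common left-multiple. Two skew polynomials $P$ and $Q$ are called similar if there is a nonzero $U \in \mathbb{F}_{q^r}[X,\sigma]$ such that $1$ is a right-greatest common divisor of $U$ and $P$, and $QU$ is a left-lowest common multiple of $U$ and $P$. The companion matrix $\Gamma_P$ of a monic $P = X^d + p_{d-1}X^{d-1} + \dots + p_0$ is the $d \times d$ matrix with ones just below the diagonal, last column $(-p_0, \dots, -p_{d-1})^T$, and all other entries zero; $\sigma$ acts on matrices entrywise. Let $P, Q \in \mathbb{F}_{q^r}[X,\sigma]$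 be monic. Then $P$ and $Q$ are similar if and only if the matrices $$\Gamma_P\,\sigma(\Gamma_P)\cdots\sigma^{r-1}(\Gamma_P) \quad\text{and}\quad \Gamma_Q\,\sigma(\Gamma_Q)\cdots\sigma^{r-1}(\Gamma_Q)$$ are conjugate, i.e. they have the same size $d$ and are conjugate by an element of $\mathrm{GL}_d(\mathbb{F}_{q^r})$. -/

import Mathlib

noncomputable section

universe u

/-- The action of the monoid `(ℕ, +)` on `K` for which `n` acts as the iterate `σ ^ n`. -/
@[reducible]
def skewAction {K : Type u} [Field K] (σ : K →+* K) :
    MulSemiringAction (Multiplicative ℕ) K :=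
  MulSemiringAction.compHom K (powersHom (K →+* K) σ)

/-- The skew polynomial ring `K[X, σ]`: usual polynomials `∑ aᵢ X ^ i` over `K` with the usual
addition, and the multiplication determined by `X * a = σ a * X`. -/
def SkewPoly {K : Type u} [Field K] (_σ : K →+* K) : Type u := SkewPolynomial K

namespace SkewPoly

variable {K : Type u} [Field K] {σ : K →+* K}

instance instRing : Ring (SkewPoly σ) :=
  letI := skewAction σ
  inferInstanceAs (Ring (SkewPolynomial K))

/-- The coefficient of `X ^ n`. -/
def coeff (P : SkewPoly σ) (n : ℕ) : K := SkewPolynomial.coeff (R := K) P n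

/-- The monomial `c X ^ n`. -/
def monomial (n : ℕ) (c : K) : SkewPoly σ := SkewPolynomial.monomial (R := K) n c

/-- The multiplication of `K[X, σ]` on monomials. -/
theorem monomial_mul_monomial (m n : ℕ) (b c : K) :
    (monomial m b * monomial n c : SkewPoly σ) = monomial (m + n) (b * σ^[m] c) := by
  letI := skewAction σ
  exact SkewPolynomial.monomial_mul_monomial (R := K) m n b c

theorem one_def : (1 : SkewPoly σ) = monomial 0 1 := rfl

/-- The degree, with the convention that `0` has degree `0`. -/
def natDegree (P : SkewPoly σ) : ℕ := (SkewPolynomial.support (R := K) P).sup id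

/-- The leading coefficient is `1`. -/
def Monic (P : SkewPoly σ) : Prop := P.coeff P.natDegree = 1

/-- `P` is a right-divisor of `Q` (equivalently `Q` is a left-multiple of `P`). -/
def RightDvd (P Q : SkewPoly σ) : Prop := ∃ U : SkewPoly σ, Q = U * P

/-- `D` is a right-greatest common divisor of `P` and `Q`. -/
def IsRgcd (D P Q : SkewPoly σ) : Prop :=
  RightDvd D P ∧ RightDvd D Q ∧ ∀ E : SkewPoly σ, RightDvd E P → RightDvd E Q → RightDvd E D

/-- `M` is a left-lowest common multiple of `P` and `Q`. -/
def IsLlcm (M P Q : SkewPoly σ) : Prop :=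
  RightDvd P M ∧ RightDvd Q M ∧ ∀ N : SkewPoly σ, RightDvd P N → RightDvd Q N → RightDvd M N

/-- `P` and `Q` are similar: there is a nonzero `U` such that `1` is a right-greatest common
divisor of `U` and `P`, and `Q * U` is a left-lowest common multiple of `U` and `P`. -/
def Similar (P Q : SkewPoly σ) : Prop :=
  ∃ U : SkewPoly σ, U ≠ 0 ∧ IsRgcd 1 U P ∧ IsLlcm (Q * U) U P

/-- The companion matrix of `P = X ^ d + p_{d-1} X ^ (d-1) + ⋯ + p_0`: ones below the diagonal
and last column `(-p_0, …, -p_{d-1})`. -/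
def companion (P : SkewPoly σ) : Matrix (Fin P.natDegree) (Fin P.natDegree) K :=
  Matrix.of fun i j =>
    if (j : ℕ) + 1 = P.natDegree then -P.coeff i
    else if (i : ℕ) = (j : ℕ) + 1 then 1 else 0

end SkewPoly

/-- The product `G * σ(G) * σ²(G) * ⋯ * σ^(r-1)(G)`, where `σ` acts on matrices entrywise. -/
def sigmaNorm {K : Type u} [Field K] {d : ℕ} (σ : K →+* K) (r : ℕ)
    (G : Matrix (Fin d) (Fin d) K) : Matrix (Fin d) (Fin d) K :=
  ((List.range r).map fun i => G.map (σ^[i])).prod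

/-- Two square matrices over `K` are conjugate: they have the same size `d`, and they are
conjugate by an element of `GL_d(K)`. -/
def MatrixConj {K : Type u} [Field K] {m n : ℕ}
    (A : Matrix (Fin m) (Fin m) K) (B : Matrix (Fin n) (Fin n) K) : Prop :=
  ∃ h : m = n, IsConj (Matrix.reindex (finCongr h) (finCongr h) A) B

end

/-! ### Galois descent and counting of intertwining maps -/

section Descent

variable {K V W : Type*} [Field K] [AddCommGroup V] [Module K V] [AddCommGroup W] [Module K W]
  {σ : K →+* K}

/-! Put `M_P = K[X, σ] / K[X, σ] P`. In the basis `1, X, …, X ^ (d - 1)`, multiplication by `X` is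
the semilinear map `φ_P : v ↦ Γ_P σ(v)`, so `M_P` is cyclic under `φ_P`. Similarity of `P` and `Q`
says exactly that `M_Q ≅ M_P`, the isomorphism being right multiplication by `U`
(`similar_of_equiv`, `Similar.exists_equiv`). As `σ ^ r = 1`, the map `φ_P ^ r` is linear, and its
matrix is `Γ_P σ(Γ_P) ⋯ σ^(r-1)(Γ_P)` (`matrixSemilinear_iterate`). What must be shown is that
cyclic semilinear maps with conjugate `r`-th powers are themselves conjugate
(`exists_intertwining_equiv`); the other direction is immediate.

Fitting's decomposition for the `r`-th powers splits both spaces into a nilpotent and a bijective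
part, matched by the given conjugation. The nilpotent parts are cyclic, hence single chains,
determined by their dimension. Cyclicity is essential there: for `r ≥ 2`, different nilpotent maps
can have the same `r`-th power.

On the bijective parts, `f ↦ ψ f φ⁻¹` is a semilinear action of order `r` on the maps intertwining
the `r`-th powers, and its fixed points intertwine `φ` and `ψ`. By descent, the former number the
`r`-th power of the latter. Thus there are as many intertwiners `V → V` as `V → W`, even with a
prescribed stable subspace in the kernel. Lovász's argument passes from these counts to injective
intertwiners; the identity of `V` is one, so there is one from `V` to `W`. -/

theorem semilinear_iterate_smul (φ : V →ₛₗ[σ] V) (n : ℕ) (c : K) (x : V) :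
    φ^[n] (c • x) = σ^[n] c • φ^[n] x := by
  induction n generalizing c x with
  | zero => rfl
  | succ n ih => simp only [Function.iterate_succ_apply, map_smulₛₗ, ih]

theorem semilinear_iterate_sum (φ : V →ₛₗ[σ] V) (n : ℕ) {ι : Type*} (s : Finset ι) (f : ι → V) :
    φ^[n] (∑ i ∈ s, f i) = ∑ i ∈ s, φ^[n] (f i) := by
  induction n generalizing f with
  | zero => rfl
  | succ n ih => simp only [Function.iterate_succ_apply, map_sum, ih]

theorem ringHom_iterate_sum (σ : K →+* K) (n : ℕ) {ι : Type*} (s : Finset ι) (f : ι → K) :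
    σ^[n] (∑ i ∈ s, f i) = ∑ i ∈ s, σ^[n] (f i) := by
  induction n generalizing f with
  | zero => rfl
  | succ n ih => simp only [Function.iterate_succ_apply, map_sum, ih]

/-- Galois descent for a cyclic group: a space with a semilinear automorphism of order `r` is
`r` copies of its fixed points, provided some `ζ` has `r` distinct conjugates. -/
theorem nonempty_fixed_equiv {r : ℕ} (hr : 0 < r) (φ : V →ₛₗ[σ] V) (ζ : K)
    (hζ : Function.Injective fun i : Fin r => σ^[i] ζ) (hσ : ∀ x, σ^[r] x = x)
    (hφ : ∀ v, φ^[r] v = v) :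
    Nonempty ((Fin r → {v : V // φ v = v}) ≃ V) := by
  obtain ⟨E, hE⟩ : ∃ E : Matrix (Fin r) (Fin r) K,
      E * Matrix.vandermonde (fun i : Fin r => σ^[i] ζ) = 1 ∧
      Matrix.vandermonde (fun i : Fin r => σ^[i] ζ) * E = 1 := by
    have hu : IsUnit (Matrix.vandermonde (fun i : Fin r => σ^[i] ζ)).det :=
      isUnit_iff_ne_zero.2 (Matrix.det_vandermonde_ne_zero_iff.2 hζ)
    exact ⟨_, Matrix.nonsing_inv_mul _ hu, Matrix.mul_nonsing_inv _ hu⟩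
  have fix_iter (v : {v : V // φ v = v}) (n : ℕ) : φ^[n] v.1 = v.1 :=
    Function.iterate_fixed v.2 n
  let Θ : (Fin r → {v : V // φ v = v}) → V := fun v => ∑ j : Fin r, ζ ^ (j : ℕ) • (v j).1
  have hΘ (v) (i : ℕ) : φ^[i] (Θ v) = ∑ j : Fin r, (σ^[i] ζ) ^ (j : ℕ) • (v j).1 := by
    simp only [Θ, semilinear_iterate_sum, semilinear_iterate_smul, fix_iter, iterate_map_pow]
  -- Applying all `φ^[i]` to `Θ v` gives a Vandermonde system in the fixed vectors `v j`, which `E`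
  -- solves.
  have hinv (v) (l : Fin r) : ∑ i : Fin r, E l i • φ^[i] (Θ v) = (v l).1 := by
    simp only [hΘ, Finset.smul_sum, smul_smul]
    rw [Finset.sum_comm]
    have : ∀ j : Fin r, ∑ i : Fin r, (E l i * (σ^[i] ζ) ^ (j : ℕ)) • (v j).1 =
        (1 : Matrix (Fin r) (Fin r) K) l j • (v j).1 := by
      intro j
      rw [← hE.1, Matrix.mul_apply, Finset.sum_smul]
      rfl
    simp [this, Matrix.one_apply]
  refine ⟨Equiv.ofBijective Θ ⟨fun v w h => funext fun l => Subtype.ext ?_, fun v => ?_⟩⟩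
  · rw [← hinv v, ← hinv w, h]
  · have : NeZero r := ⟨hr.ne'⟩
    -- The `b j` form the trace-dual basis of the powers `ζ ^ j`: the preimage of `v` will have the
    -- traces `∑ i, φ^[i] (b j • v)` as components.
    let b : Fin r → K := fun j => E j 0
    have hb (i : ℕ) (hi : i < r) : ∑ j : Fin r, (σ^[i] ζ) ^ (j : ℕ) * b j = if i = 0 then 1 else 0 := by
      have := congrFun (congrFun hE.2 ⟨i, hi⟩) 0
      rw [Matrix.mul_apply, Matrix.one_apply] at this
      simpa [Fin.ext_iff] using this
    have hb' (i : ℕ) (hi : i < r) :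
        ∑ j : Fin r, ζ ^ (j : ℕ) * σ^[i] (b j) = if i = 0 then 1 else 0 := by
      rcases Nat.eq_zero_or_pos i with rfl | h0
      · simpa using hb 0 hr
      · have h1 := congrArg (σ^[i]) (hb (r - i) (by omega))
        rw [ringHom_iterate_sum, if_neg (by omega), iterate_map_zero] at h1
        rw [if_neg h0.ne', ← h1]
        refine Finset.sum_congr rfl fun j _ => ?_
        rw [iterate_map_mul, iterate_map_pow, ← Function.iterate_add_apply,
          Nat.add_sub_of_le hi.le, hσ]
    have hfix (w : V) : φ (∑ i ∈ Finset.range r, φ^[i] w) = ∑ i ∈ Finset.range r, φ^[i] w := by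
      rw [map_sum]
      simp only [← Function.iterate_succ_apply' (f := φ)]
      have h1 := Finset.sum_range_succ (fun i => φ^[i] w) r
      rw [Finset.sum_range_succ', hφ] at h1
      exact add_right_cancel h1
    refine ⟨fun j => ⟨_, hfix (b j • v)⟩, ?_⟩
    simp only [Θ, semilinear_iterate_smul, Finset.smul_sum, smul_smul]
    rw [Finset.sum_comm]
    simp only [← Finset.sum_smul]
    rw [Finset.sum_congr rfl fun i hi => by rw [hb' i (Finset.mem_range.1 hi)]]
    simp [hr]

theorem semilinear_symm_smul (e : V ≃ V) (φ : V →ₛₗ[σ] V)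
    (he : ∀ x, e x = φ x) (c : K) (x : V) : e.symm (σ c • x) = c • e.symm x := by
  apply e.injective
  rw [he (c • _), φ.map_smulₛₗ, ← he, e.apply_symm_apply, e.apply_symm_apply]

/-- Linear maps that commute with `φ ^ r`, `ψ ^ r` and vanish on `S`. -/
def iterateHom (φ : V →ₛₗ[σ] V) (ψ : W →ₛₗ[σ] W) (r : ℕ) (hσ : ∀ x, σ^[r] x = x)
    (S : Submodule K V) : Submodule K (V →ₗ[K] W) where
  carrier := {f | (∀ x, f (φ^[r] x) = ψ^[r] (f x)) ∧ ∀ x ∈ S, f x = 0}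
  add_mem' := fun hf hg => ⟨fun x => by simp [hf.1, hg.1, iterate_map_add],
    fun x hx => by simp [hf.2 x hx, hg.2 x hx]⟩
  zero_mem' := by simp [iterate_map_zero]
  smul_mem' := fun c f hf => ⟨fun x => by simp [hf.1, semilinear_iterate_smul, hσ],
    fun x hx => by simp [hf.2 x hx]⟩

/-- Linear maps that intertwine `φ` and `ψ` and vanish on `S`. -/
def Intertwiner (φ : V →ₛₗ[σ] V) (ψ : W →ₛₗ[σ] W) (S : Submodule K V) : Set (V →ₗ[K] W) :=
  {f | (∀ x, f (φ x) = ψ (f x)) ∧ S ≤ LinearMap.ker f}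

theorem intertwiner_iterate {φ : V →ₛₗ[σ] V} {ψ : W →ₛₗ[σ] W} {f : V →ₗ[K] W}
    (h : ∀ x, f (φ x) = ψ (f x)) (n : ℕ) (x : V) : f (φ^[n] x) = ψ^[n] (f x) :=
  (Function.Semiconj.iterate_right (f := f) (ga := φ) (gb := ψ) h n) x

/-- Descent applied to `Φ f = ψ ∘ f ∘ φ⁻¹` on `iterateHom`. Commuting with the `r`-th powers means
`Φ ^ r = 1`, and the fixed points of `Φ` are the intertwiners. Finiteness of `V` makes `φ`
invertible and `S` stable under the inverse. -/
theorem nonempty_intertwiner_equiv {r : ℕ} (hr : 0 < r) [Finite V] (φ : V →ₛₗ[σ] V)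
    (ψ : W →ₛₗ[σ] W) (hφ : Function.Injective φ) (ζ : K)
    (hζ : Function.Injective fun i : Fin r => σ^[i] ζ) (hσ : ∀ x, σ^[r] x = x)
    (S : Submodule K V) (hS : ∀ x ∈ S, φ x ∈ S) :
    Nonempty ((Fin r → Intertwiner φ ψ S) ≃ iterateHom φ ψ r hσ S) := by
  have hσs : Function.Surjective σ := by
    obtain ⟨n, rfl⟩ := Nat.exists_eq_succ_of_ne_zero hr.ne'
    exact fun x => ⟨σ^[n] x, by rw [← Function.iterate_succ_apply' (f := σ), hσ]⟩
  let e : V ≃ V := Equiv.ofBijective φ (Finite.injective_iff_bijective.1 hφ)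
  have he (x) : e x = φ x := rfl
  have hes (x : V) : φ (e.symm x) = x := e.apply_symm_apply x
  have hse (x : V) : e.symm (φ x) = x := e.symm_apply_apply x
  have hadd (x y : V) : e.symm (x + y) = e.symm x + e.symm y := by
    apply e.injective
    simp [he, hes]
  have hsm := semilinear_symm_smul e φ he
  have heS : ∀ x ∈ S, e.symm x ∈ S := by
    intro x hx
    let φS : S → S := fun x => ⟨φ x, hS x x.2⟩
    have : Function.Injective φS := fun x y h => Subtype.ext (hφ (congrArg Subtype.val h))
    obtain ⟨y, hy⟩ := (Finite.injective_iff_surjective.1 this) ⟨x, hx⟩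
    have : φ y = x := congrArg Subtype.val hy
    rw [← this, hse]
    exact y.2
  let Φ₀ (f : V →ₗ[K] W) : V →ₗ[K] W :=
    { toFun := fun x => ψ (f (e.symm x))
      map_add' := fun x y => by rw [hadd, map_add, map_add]
      map_smul' := fun c x => by
        obtain ⟨c, rfl⟩ := hσs c
        rw [hsm, map_smul, map_smulₛₗ, RingHom.id_apply] }
  let Φ : iterateHom φ ψ r hσ S →ₛₗ[σ] iterateHom φ ψ r hσ S :=
    { toFun := fun f => ⟨Φ₀ f.1, fun x => by
          change ψ (f.1 (e.symm (φ^[r] x))) = ψ^[r] (ψ (f.1 (e.symm x)))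
          have : e.symm (φ^[r] x) = φ^[r] (e.symm x) := by
            apply e.injective
            rw [he, he, hes, ← Function.iterate_succ_apply' (f := φ), Function.iterate_succ_apply,
              hes]
          rw [this, f.2.1, ← Function.iterate_succ_apply' (f := ψ), Function.iterate_succ_apply],
        fun x hx => by
          change ψ (f.1 (e.symm x)) = 0
          rw [f.2.2 _ (heS x hx), map_zero]⟩
      map_add' := fun f g => Subtype.ext (LinearMap.ext fun x => by simp [Φ₀])
      map_smul' := fun c f => Subtype.ext (LinearMap.ext fun x => by simp [Φ₀]) }
  have hΦ (f) (x) : (Φ f).1 (φ x) = ψ (f.1 x) := by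
    change ψ (f.1 (e.symm (φ x))) = _
    rw [hse]
  have hΦi (n : ℕ) : ∀ f x, (Φ^[n] f).1 (φ^[n] x) = ψ^[n] (f.1 x) := by
    induction n with
    | zero => exact fun _ _ => rfl
    | succ n ih =>
      intro f x
      rw [Function.iterate_succ_apply, Function.iterate_succ_apply, ih, hΦ,
        Function.iterate_succ_apply]
  have hsurj : Function.Surjective φ := Finite.injective_iff_surjective.1 hφ
  have hr' (f) : Φ^[r] f = f := by
    refine Subtype.ext (LinearMap.ext fun x => ?_)
    obtain ⟨x, rfl⟩ := hsurj.iterate r x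
    rw [hΦi, f.2.1]
  have hfix : Nonempty (Intertwiner φ ψ S ≃ {f // Φ f = f}) := by
    refine ⟨⟨fun f => ⟨⟨f.1, fun x => intertwiner_iterate f.2.1 r x, fun x hx => f.2.2 hx⟩,
      Subtype.ext (LinearMap.ext fun x => ?_)⟩, fun f => ⟨f.1.1, fun x => ?_, fun x hx =>
        f.1.2.2 x hx⟩, fun f => rfl, fun f => rfl⟩⟩
    · obtain ⟨x, rfl⟩ := hsurj x
      rw [hΦ]
      exact (f.2.1 x).symm
    · rw [← hΦ, f.2]
  obtain ⟨e1⟩ := hfix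
  obtain ⟨e2⟩ := nonempty_fixed_equiv hr Φ ζ hζ hσ hr'
  exact ⟨(Equiv.piCongrRight fun _ => e1).trans e2⟩

/-- Composition with `g` identifies the two `iterateHom` spaces, so the two counts have equal `r`-th
powers. -/
theorem card_intertwiner_eq {r : ℕ} (hr : 0 < r) [Finite V] [Finite W] (φ : V →ₛₗ[σ] V)
    (ψ : W →ₛₗ[σ] W) (hφ : Function.Injective φ) (ζ : K)
    (hζ : Function.Injective fun i : Fin r => σ^[i] ζ) (hσ : ∀ x, σ^[r] x = x)
    (g : V ≃ₗ[K] W) (hg : ∀ x, g (φ^[r] x) = ψ^[r] (g x))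
    (S : Submodule K V) (hS : ∀ x ∈ S, φ x ∈ S) :
    Nat.card (Intertwiner φ φ S) = Nat.card (Intertwiner φ ψ S) := by
  obtain ⟨e1⟩ := nonempty_intertwiner_equiv hr φ φ hφ ζ hζ hσ S hS
  obtain ⟨e2⟩ := nonempty_intertwiner_equiv hr φ ψ hφ ζ hζ hσ S hS
  have hg' (y) : g.symm (ψ^[r] y) = φ^[r] (g.symm y) := by
    apply g.injective
    rw [hg, g.apply_symm_apply, g.apply_symm_apply]
  let e3 : iterateHom φ φ r hσ S ≃ iterateHom φ ψ r hσ S :=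
    { toFun := fun f => ⟨g.toLinearMap ∘ₗ f.1, fun x => by simp [f.2.1, hg],
        fun x hx => by simp [f.2.2 x hx]⟩
      invFun := fun f => ⟨g.symm.toLinearMap ∘ₗ f.1, fun x => by simp [f.2.1, hg'],
        fun x hx => by simp [f.2.2 x hx]⟩
      left_inv := fun f => by ext; simp
      right_inv := fun f => by ext; simp }
  have h := Nat.card_congr ((e1.trans e3).trans e2.symm)
  rw [Nat.card_fun, Nat.card_fun, Nat.card_fin] at h
  exact Nat.pow_left_injective hr.ne' h

/-- Sorting by kernel isolates the kernel `S` from the strictly larger ones, to which downward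
induction applies. -/
theorem card_intertwiner_eq_add [Finite V] [Finite W] (φ : V →ₛₗ[σ] V) (ψ : W →ₛₗ[σ] W)
    (S : Submodule K V) :
    Nat.card (Intertwiner φ ψ S) =
      Nat.card {f : V →ₗ[K] W // (∀ x, f (φ x) = ψ (f x)) ∧ LinearMap.ker f = S} +
      Nat.card (Σ T : {T : Submodule K V // S < T},
        {f : V →ₗ[K] W // (∀ x, f (φ x) = ψ (f x)) ∧ LinearMap.ker f = T}) := by
  classical
  have : Finite (V →ₗ[K] W) := DFunLike.finite _
  rw [← Nat.card_sum]
  refine Nat.card_congr ⟨fun f => if hf : LinearMap.ker f.1 = S then .inl ⟨f.1, f.2.1, hf⟩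
    else .inr ⟨⟨LinearMap.ker f.1, lt_of_le_of_ne f.2.2 (Ne.symm hf)⟩, f.1, f.2.1, rfl⟩,
    Sum.elim (fun f => ⟨f.1, f.2.1, f.2.2.ge⟩)
      (fun f => ⟨f.2.1, f.2.2.1, f.1.2.le.trans f.2.2.2.ge⟩), fun f => ?_, fun f => ?_⟩
  · dsimp only
    split_ifs <;> rfl
  · rcases f with f | ⟨⟨T, hT⟩, f, hf, hk⟩
    · simp [f.2.2]
    · change LinearMap.ker f = T at hk
      subst hk
      have : LinearMap.ker f ≠ S := hT.ne'
      simp [this]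

/-- Lovász's counting argument. -/
theorem card_intertwiner_ker_eq [Finite V] [Finite W] (φ : V →ₛₗ[σ] V) (ψ : W →ₛₗ[σ] W)
    (h : ∀ S : Submodule K V, (∀ x ∈ S, φ x ∈ S) →
      Nat.card (Intertwiner φ φ S) = Nat.card (Intertwiner φ ψ S)) (S : Submodule K V) :
    Nat.card {f : V →ₗ[K] V // (∀ x, f (φ x) = φ (f x)) ∧ LinearMap.ker f = S} =
      Nat.card {f : V →ₗ[K] W // (∀ x, f (φ x) = ψ (f x)) ∧ LinearMap.ker f = S} := by
  induction S using WellFoundedGT.induction with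
  | ind S ih =>
  by_cases hS : ∀ x ∈ S, φ x ∈ S
  · have h1 := h S hS
    rw [card_intertwiner_eq_add φ φ, card_intertwiner_eq_add φ ψ] at h1
    have h2 : Nat.card (Σ T : {T : Submodule K V // S < T},
            {f : V →ₗ[K] V // (∀ x, f (φ x) = φ (f x)) ∧ LinearMap.ker f = T}) =
        Nat.card (Σ T : {T : Submodule K V // S < T},
            {f : V →ₗ[K] W // (∀ x, f (φ x) = ψ (f x)) ∧ LinearMap.ker f = T}) := by
      have : Finite (V →ₗ[K] V) := DFunLike.finite _
      have : Finite (V →ₗ[K] W) := DFunLike.finite _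
      have := Fintype.ofFinite {T : Submodule K V // S < T}
      rw [Nat.card_sigma, Nat.card_sigma]
      exact Finset.sum_congr rfl fun T _ => ih T.1 T.2
    omega
  -- The kernel of an intertwiner is stable, so for an unstable `S` both counts vanish.
  · have h1 : IsEmpty {f : V →ₗ[K] V // (∀ x, f (φ x) = φ (f x)) ∧ LinearMap.ker f = S} := by
      refine ⟨fun ⟨f, hf, hk⟩ => hS fun x hx => ?_⟩
      rw [← hk, LinearMap.mem_ker] at hx ⊢
      rw [hf, hx, map_zero]
    have h2 : IsEmpty {f : V →ₗ[K] W // (∀ x, f (φ x) = ψ (f x)) ∧ LinearMap.ker f = S} := by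
      refine ⟨fun ⟨f, hf, hk⟩ => hS fun x hx => ?_⟩
      rw [← hk, LinearMap.mem_ker] at hx ⊢
      rw [hf, hx, map_zero]
    simp

/-- Two bijective semilinear maps whose `r`-th powers are conjugate are conjugate. -/
theorem exists_intertwining_equiv_of_injective {r : ℕ} (hr : 0 < r) [Finite V] [Finite W]
    (φ : V →ₛₗ[σ] V) (ψ : W →ₛₗ[σ] W) (hφ : Function.Injective φ) (ζ : K)
    (hζ : Function.Injective fun i : Fin r => σ^[i] ζ) (hσ : ∀ x, σ^[r] x = x)
    (g : V ≃ₗ[K] W) (hg : ∀ x, g (φ^[r] x) = ψ^[r] (g x)) :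
    ∃ h : V ≃ₗ[K] W, ∀ x, h (φ x) = ψ (h x) := by
  have h1 := card_intertwiner_ker_eq φ ψ
    (fun S hS => card_intertwiner_eq hr φ ψ hφ ζ hζ hσ g hg S hS) ⊥
  have : Finite (V →ₗ[K] V) := DFunLike.finite _
  have : Nonempty {f : V →ₗ[K] V // (∀ x, f (φ x) = φ (f x)) ∧ LinearMap.ker f = ⊥} :=
    ⟨LinearMap.id, fun _ => rfl, LinearMap.ker_id⟩
  obtain ⟨f, hf, hk⟩ := (Nat.card_pos_iff.1 (h1 ▸ Nat.card_pos)).1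
  have hb : Function.Bijective f :=
    (Nat.bijective_iff_injective_and_card f).2 ⟨LinearMap.ker_eq_bot.1 hk,
      Nat.card_congr g.toEquiv⟩
  exact ⟨LinearEquiv.ofBijective f hb, hf⟩

end Descent

/-! ### Fitting decomposition and the nilpotent part -/

section Fitting

variable {K V W : Type*} [Field K] [AddCommGroup V] [Module K V] [AddCommGroup W] [Module K W]
  {σ : K →+* K}

/-- With `s` the least exponent killing `m`, the chain `m, φ m, …, φ^[s-1] m` spans, and it is
independent as in the linear case. -/
theorem exists_basis_of_cyclic_nilpotent (φ : V →ₛₗ[σ] V) (m : V)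
    (hm : Submodule.span K (Set.range fun n => φ^[n] m) = ⊤) {N : ℕ} (hN : φ^[N] m = 0) :
    ∃ (s : ℕ) (b : Module.Basis (Fin s) K V), (∀ i, b i = φ^[i] m) ∧ φ^[s] m = 0 := by
  classical
  have hex : ∃ s, φ^[s] m = 0 := ⟨N, hN⟩
  set s := Nat.find hex with hs
  have hs0 : φ^[s] m = 0 := Nat.find_spec hex
  have hge (j : ℕ) (hj : s ≤ j) : φ^[j] m = 0 := by
    obtain ⟨k, rfl⟩ := Nat.exists_eq_add_of_le' hj
    rw [Function.iterate_add_apply, hs0, iterate_map_zero]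
  have hli : LinearIndependent K (fun i : Fin s => φ^[i] m) := by
    rw [Fintype.linearIndependent_iff]
    intro c hc
    have key (n : ℕ) : ∀ i : Fin s, (i : ℕ) = n → c i = 0 := by
      induction n using Nat.strong_induction_on with
      | _ n ih =>
      rintro i rfl
      -- This power kills all terms beyond `i` and sends the `i`-th one to a multiple of `φ^[s-1] m
      -- ≠ 0`; the earlier coefficients are already zero.
      have h1 := congrArg (φ^[s - 1 - i]) hc
      rw [semilinear_iterate_sum, iterate_map_zero, Finset.sum_eq_single i] at h1
      · rw [semilinear_iterate_smul, ← Function.iterate_add_apply,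
          Nat.sub_add_cancel (by omega)] at h1
        have h2 : φ^[s - 1] m ≠ 0 := Nat.find_min hex (m := s - 1) (by have := i.isLt; omega)
        have h3 := (smul_eq_zero.1 h1).resolve_right h2
        exact σ.injective.iterate _ (h3.trans (iterate_map_zero σ _).symm)
      · intro j _ hj
        rcases lt_or_gt_of_ne (fun h => hj (Fin.ext h)) with h | h
        · rw [ih j h j rfl, zero_smul, iterate_map_zero]
        · rw [semilinear_iterate_smul, ← Function.iterate_add_apply, hge _ (by omega), smul_zero]
      · simp
    exact fun i => key i i rfl
  have hsp : ⊤ ≤ Submodule.span K (Set.range fun i : Fin s => φ^[i] m) := by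
    rw [← hm, Submodule.span_le]
    rintro _ ⟨n, rfl⟩
    by_cases hn : n < s
    · exact Submodule.subset_span ⟨⟨n, hn⟩, rfl⟩
    · simp [hge n (not_lt.1 hn)]
  exact ⟨s, Module.Basis.mk hli hsp, fun i => by simp, hs0⟩

theorem exists_intertwining_equiv_of_nilpotent (φ : V →ₛₗ[σ] V) (ψ : W →ₛₗ[σ] W) {v : V} {w : W}
    (hv : Submodule.span K (Set.range fun n => φ^[n] v) = ⊤)
    (hw : Submodule.span K (Set.range fun n => ψ^[n] w) = ⊤)
    {N : ℕ} (hφ : φ^[N] v = 0) (hψ : ψ^[N] w = 0)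
    (hd : Module.finrank K V = Module.finrank K W) :
    ∃ h : V ≃ₗ[K] W, ∀ x, h (φ x) = ψ (h x) := by
  obtain ⟨s, b, hb, hs⟩ := exists_basis_of_cyclic_nilpotent φ v hv hφ
  obtain ⟨t, c, hc, ht⟩ := exists_basis_of_cyclic_nilpotent ψ w hw hψ
  obtain rfl : s = t := by
    simpa [Module.finrank_eq_card_basis b, Module.finrank_eq_card_basis c] using hd
  let h := b.equiv c (Equiv.refl _)
  have hbas (i : Fin s) : h (φ (b i)) = ψ (h (b i)) := by
    rw [Module.Basis.equiv_apply, Equiv.refl_apply, hb, hc, ← Function.iterate_succ_apply' (f := φ),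
      ← Function.iterate_succ_apply' (f := ψ)]
    by_cases hi : (i : ℕ) + 1 < s
    · rw [Nat.succ_eq_add_one, ← hb ⟨i + 1, hi⟩, ← hc ⟨i + 1, hi⟩, Module.Basis.equiv_apply]
      rfl
    · have : (i : ℕ).succ = s := by omega
      rw [this, hs, ht, map_zero]
  refine ⟨h, fun x => ?_⟩
  rw [← b.sum_repr x]
  simp only [map_sum, map_smulₛₗ, hbas, RingHom.id_apply]

/-- The `r`-th iterate of a semilinear map, as a linear map when `σ ^ r = 1`. -/
def iterateLinear (φ : V →ₛₗ[σ] V) (r : ℕ) (hσ : ∀ x, σ^[r] x = x) : V →ₗ[K] V where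
  toFun := φ^[r]
  map_add' := iterate_map_add φ r
  map_smul' c x := by rw [semilinear_iterate_smul, hσ, RingHom.id_apply]

theorem iterateLinear_pow_apply (φ : V →ₛₗ[σ] V) (r : ℕ) (hσ : ∀ x, σ^[r] x = x) (n : ℕ) (x : V) :
    (iterateLinear φ r hσ ^ n) x = φ^[r * n] x := by
  rw [Module.End.pow_apply, Function.iterate_mul]
  rfl

theorem iterate_restrict_coe (φ : V →ₛₗ[σ] V) (S : Submodule K V) (hS : ∀ x ∈ S, φ x ∈ S)
    (n : ℕ) (x : S) : (((φ.restrict hS)^[n] x : S) : V) = φ^[n] x := by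
  induction n generalizing x with
  | zero => rfl
  | succ n ih => rw [Function.iterate_succ_apply, ih]; rfl

/-- The projection onto `S` along `T` commutes with `φ`, so it carries a cyclic vector to a cyclic
vector. -/
theorem exists_cyclic_of_isCompl (φ : V →ₛₗ[σ] V) {S T : Submodule K V} (hST : IsCompl S T)
    (hS : ∀ x ∈ S, φ x ∈ S) (hT : ∀ x ∈ T, φ x ∈ T) {v : V}
    (hv : Submodule.span K (Set.range fun n => φ^[n] v) = ⊤) :
    ∃ m : S, Submodule.span K (Set.range fun n => (φ.restrict hS)^[n] m) = ⊤ := by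
  have hcomm (x : V) : S.projectionOnto T hST (φ x) =
      φ.restrict hS (S.projectionOnto T hST x) := by
    obtain ⟨y, hy, z, hz, rfl⟩ := Submodule.mem_sup.1 (hST.sup_eq_top ▸ Submodule.mem_top (x := x))
    rw [map_add, map_add, map_add, (Submodule.projectionOnto_apply_eq_zero_iff hST).2 hz,
      (Submodule.projectionOnto_apply_eq_zero_iff hST).2 (hT z hz),
      Submodule.projectionOnto_apply_of_mem_left hST hy,
      Submodule.projectionOnto_apply_of_mem_left hST (hS y hy), add_zero, add_zero]
    rfl
  have hcomm' (n : ℕ) (x : V) : S.projectionOnto T hST (φ^[n] x) =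
      (φ.restrict hS)^[n] (S.projectionOnto T hST x) :=
    (Function.Semiconj.iterate_right (f := S.projectionOnto T hST) (ga := φ)
      (gb := φ.restrict hS) hcomm n) x
  refine ⟨S.projectionOnto T hST v, ?_⟩
  simp only [← hcomm']
  have := congrArg (Submodule.map (S.projectionOnto T hST)) hv
  rw [Submodule.map_top, Submodule.range_projectionOnto, Submodule.map_span, ← Set.range_comp] at this
  exact this

theorem exists_intertwining_equiv_of_isCompl (φ : V →ₛₗ[σ] V) (ψ : W →ₛₗ[σ] W)
    {S T : Submodule K V} {S' T' : Submodule K W} (hST : IsCompl S T) (hST' : IsCompl S' T')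
    (h₁ : S ≃ₗ[K] S') (h₂ : T ≃ₗ[K] T')
    (hS : ∀ x : S, ∃ hx : φ x ∈ S, (h₁ ⟨φ x, hx⟩ : W) = ψ (h₁ x))
    (hT : ∀ x : T, ∃ hx : φ x ∈ T, (h₂ ⟨φ x, hx⟩ : W) = ψ (h₂ x)) :
    ∃ h : V ≃ₗ[K] W, ∀ x, h (φ x) = ψ (h x) := by
  let e := S.prodEquivOfIsCompl T hST
  let h := e.symm.trans ((h₁.prodCongr h₂).trans (S'.prodEquivOfIsCompl T' hST'))
  have hh (s : S) (t : T) : h (s + t) = h₁ s + h₂ t := by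
    have : (s + t : V) = e (s, t) := rfl
    simp only [h, LinearEquiv.trans_apply]
    rw [this, e.symm_apply_apply]
    rfl
  refine ⟨h, fun x => ?_⟩
  obtain ⟨y, hy, z, hz, rfl⟩ := Submodule.mem_sup.1 (hST.sup_eq_top ▸ Submodule.mem_top (x := x))
  obtain ⟨h1, h1'⟩ := hS ⟨y, hy⟩
  obtain ⟨h2, h2'⟩ := hT ⟨z, hz⟩
  have e1 := hh ⟨y, hy⟩ ⟨z, hz⟩
  have e2 := hh ⟨φ y, h1⟩ ⟨φ z, h2⟩
  simp only at e1 e2 h1' h2'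
  rw [map_add, e1, e2, map_add, h1', h2']

/-- Cyclic semilinear maps whose `r`-th powers are conjugate are conjugate. -/
theorem exists_intertwining_equiv {r : ℕ} (hr : 0 < r) [Finite V] [Finite W]
    (φ : V →ₛₗ[σ] V) (ψ : W →ₛₗ[σ] W) (ζ : K)
    (hζ : Function.Injective fun i : Fin r => σ^[i] ζ) (hσ : ∀ x, σ^[r] x = x)
    {v : V} {w : W} (hv : Submodule.span K (Set.range fun n => φ^[n] v) = ⊤)
    (hw : Submodule.span K (Set.range fun n => ψ^[n] w) = ⊤)
    (g : V ≃ₗ[K] W) (hg : ∀ x, g (φ^[r] x) = ψ^[r] (g x)) :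
    ∃ h : V ≃ₗ[K] W, ∀ x, h (φ x) = ψ (h x) := by
  -- One exponent serves both maps; `1 ≤ n` ensures that `ker φ` lies in the nilpotent part.
  obtain ⟨n, ⟨hV, hW⟩, hn⟩ :=
    (((iterateLinear φ r hσ).eventually_isCompl_ker_pow_range_pow.and
      (iterateLinear ψ r hσ).eventually_isCompl_ker_pow_range_pow).and
        (Filter.eventually_ge_atTop 1)).exists
  set V₀ := LinearMap.ker (iterateLinear φ r hσ ^ n) with hV₀
  set V₁ := LinearMap.range (iterateLinear φ r hσ ^ n) with hV₁
  set W₀ := LinearMap.ker (iterateLinear ψ r hσ ^ n) with hW₀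
  set W₁ := LinearMap.range (iterateLinear ψ r hσ ^ n) with hW₁
  have mV₀ (x : V) : x ∈ V₀ ↔ φ^[r * n] x = 0 := by
    rw [hV₀, LinearMap.mem_ker, iterateLinear_pow_apply]
  have mV₁ (x : V) : x ∈ V₁ ↔ ∃ y, φ^[r * n] y = x := by
    simp only [hV₁, LinearMap.mem_range, iterateLinear_pow_apply]
  have mW₀ (x : W) : x ∈ W₀ ↔ ψ^[r * n] x = 0 := by
    rw [hW₀, LinearMap.mem_ker, iterateLinear_pow_apply]
  have mW₁ (x : W) : x ∈ W₁ ↔ ∃ y, ψ^[r * n] y = x := by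
    simp only [hW₁, LinearMap.mem_range, iterateLinear_pow_apply]
  have hgn (x : V) : g (φ^[r * n] x) = ψ^[r * n] (g x) := by
    rw [Function.iterate_mul, Function.iterate_mul]
    exact (Function.Semiconj.iterate_right (f := g) (ga := φ^[r]) (gb := ψ^[r]) hg n) x
  have sV₀ : ∀ x ∈ V₀, φ x ∈ V₀ := fun x hx => by
    rw [mV₀] at hx ⊢
    rw [← Function.iterate_succ_apply, Function.iterate_succ_apply', hx, map_zero]
  have sW₀ : ∀ x ∈ W₀, ψ x ∈ W₀ := fun x hx => by
    rw [mW₀] at hx ⊢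
    rw [← Function.iterate_succ_apply, Function.iterate_succ_apply', hx, map_zero]
  have sV₁ : ∀ x ∈ V₁, φ x ∈ V₁ := fun x hx => by
    rw [mV₁] at hx ⊢
    obtain ⟨y, rfl⟩ := hx
    exact ⟨φ y, by rw [← Function.iterate_succ_apply, Function.iterate_succ_apply']⟩
  have sW₁ : ∀ x ∈ W₁, ψ x ∈ W₁ := fun x hx => by
    rw [mW₁] at hx ⊢
    obtain ⟨y, rfl⟩ := hx
    exact ⟨ψ y, by rw [← Function.iterate_succ_apply, Function.iterate_succ_apply']⟩
  have g₀ : V₀.map g.toLinearMap = W₀ := by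
    ext y
    rw [mW₀, Submodule.mem_map]
    constructor
    · rintro ⟨x, hx, rfl⟩
      rw [mV₀] at hx
      simp [← hgn, hx]
    · intro hy
      refine ⟨g.symm y, (mV₀ _).2 (g.injective ?_), by simp⟩
      rw [hgn, g.apply_symm_apply, hy, map_zero]
  have g₁ : V₁.map g.toLinearMap = W₁ := by
    ext y
    rw [mW₁, Submodule.mem_map]
    constructor
    · rintro ⟨x, hx, rfl⟩
      obtain ⟨z, rfl⟩ := (mV₁ _).1 hx
      exact ⟨g z, (hgn z).symm⟩
    · rintro ⟨z, rfl⟩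
      exact ⟨φ^[r * n] (g.symm z), (mV₁ _).2 ⟨_, rfl⟩, by simp [hgn]⟩
  obtain ⟨m, hm⟩ := exists_cyclic_of_isCompl φ hV sV₀ sV₁ hv
  obtain ⟨m', hm'⟩ := exists_cyclic_of_isCompl ψ hW sW₀ sW₁ hw
  obtain ⟨h₀, hh₀⟩ := exists_intertwining_equiv_of_nilpotent (φ.restrict sV₀) (ψ.restrict sW₀)
    hm hm' (N := r * n) (Subtype.ext (by rw [iterate_restrict_coe]; exact (mV₀ _).1 m.2))
    (Subtype.ext (by rw [iterate_restrict_coe]; exact (mW₀ _).1 m'.2))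
    (g.ofSubmodules V₀ W₀ g₀).finrank_eq
  have hinj : Function.Injective (φ.restrict sV₁) := by
    rw [injective_iff_map_eq_zero]
    intro x hx
    have hx' : φ x = 0 := congrArg Subtype.val hx
    have h0 : (x : V) ∈ V₀ := by
      rw [mV₀]
      obtain ⟨k, hk⟩ := Nat.exists_eq_succ_of_ne_zero (Nat.mul_pos hr hn).ne'
      rw [hk, Function.iterate_succ_apply, hx', iterate_map_zero]
    exact Subtype.ext (Submodule.disjoint_def.1 hV.disjoint _ h0 x.2)
  obtain ⟨h₁, hh₁⟩ := exists_intertwining_equiv_of_injective hr (φ.restrict sV₁) (ψ.restrict sW₁)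
    hinj ζ hζ hσ (g.ofSubmodules V₁ W₁ g₁) (fun x => Subtype.ext (by
      rw [iterate_restrict_coe, LinearEquiv.ofSubmodules_apply, iterate_restrict_coe, hg,
        LinearEquiv.ofSubmodules_apply]))
  exact exists_intertwining_equiv_of_isCompl φ ψ hV hW h₀ h₁
    (fun x => ⟨sV₀ x x.2, congrArg Subtype.val (hh₀ x)⟩)
    (fun x => ⟨sV₁ x x.2, congrArg Subtype.val (hh₁ x)⟩)

end Fitting

/-! ### Arithmetic of skew polynomials: coefficients, division, Bézout -/

namespace SkewPoly

variable {K : Type*} [Field K] {σ : K →+* K}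

theorem ext_coeff {A B : SkewPoly σ} (h : ∀ n, A.coeff n = B.coeff n) : A = B :=
  SkewMonoidAlgebra.ext h

theorem coeff_add (A B : SkewPoly σ) (n : ℕ) : (A + B).coeff n = A.coeff n + B.coeff n :=
  congrFun (congrArg DFunLike.coe (SkewMonoidAlgebra.coeff_add (k := K) (G := Multiplicative ℕ) A B))
    _

theorem coeff_zero (n : ℕ) : (0 : SkewPoly σ).coeff n = 0 := rfl

theorem coeff_sub (A B : SkewPoly σ) (n : ℕ) : (A - B).coeff n = A.coeff n - B.coeff n := by
  rw [eq_sub_iff_add_eq, ← coeff_add, sub_add_cancel]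

theorem coeff_monomial (m n : ℕ) (c : K) :
    (monomial m c : SkewPoly σ).coeff n = if m = n then c else 0 :=
  SkewPolynomial.coeff_monomial

theorem monomial_add (n : ℕ) (b c : K) :
    (monomial n (b + c) : SkewPoly σ) = monomial n b + monomial n c :=
  SkewPolynomial.monomial_add n b c

theorem monomial_add_induction {motive : SkewPoly σ → Prop} (A : SkewPoly σ) (h0 : motive 0)
    (hm : ∀ n c, motive (monomial n c)) (hadd : ∀ B C, motive B → motive C → motive (B + C)) :
    motive A :=
  SkewPolynomial.induction (R := K) A h0 fun n r _ _ _ hq => hadd _ _ (hm n r) hq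

theorem coeff_mul (A B : SkewPoly σ) (n : ℕ) :
    (A * B).coeff n = ∑ i ∈ Finset.range (n + 1), A.coeff i * σ^[i] (B.coeff (n - i)) := by
  induction A using monomial_add_induction with
  | h0 => simp [coeff_zero]
  | hadd A₁ A₂ h₁ h₂ => simp [add_mul, coeff_add, h₁, h₂, Finset.sum_add_distrib]
  | hm m c =>
    induction B using monomial_add_induction with
    | h0 => simp [coeff_zero, iterate_map_zero]
    | hadd B₁ B₂ h₁ h₂ =>
      simp [mul_add, coeff_add, h₁, h₂, Finset.sum_add_distrib, iterate_map_add]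
    | hm k b =>
      rw [monomial_mul_monomial, coeff_monomial]
      simp only [coeff_monomial, ite_mul, zero_mul]
      rw [Finset.sum_ite_eq]
      by_cases h : m + k = n
      · subst h
        simp
      · rw [if_neg h]
        split_ifs with h1 h2
        · rw [Finset.mem_range] at h1
          omega
        · simp [iterate_map_zero]
        · rfl

theorem coeff_eq_zero_of_natDegree_lt (A : SkewPoly σ) {n : ℕ} (h : A.natDegree < n) :
    A.coeff n = 0 := by
  by_contra hn
  have : n ∈ SkewPolynomial.support (R := K) A := SkewPolynomial.mem_support_iff.2 hn
  exact absurd (Finset.le_sup (f := id) this) (not_le.2 h)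

/-- `A = X ^ n + ` (terms of lower degree). -/
def IsMonicOfDegree (A : SkewPoly σ) (n : ℕ) : Prop :=
  A.coeff n = 1 ∧ ∀ i, n < i → A.coeff i = 0

theorem Monic.isMonicOfDegree {P : SkewPoly σ} (hP : P.Monic) : P.IsMonicOfDegree P.natDegree :=
  ⟨hP, fun _ => P.coeff_eq_zero_of_natDegree_lt⟩

theorem exists_leading {A : SkewPoly σ} (hA : A ≠ 0) :
    ∃ n, A.coeff n ≠ 0 ∧ ∀ i, n < i → A.coeff i = 0 := by
  refine ⟨A.natDegree, fun h0 => hA ?_, fun _ => A.coeff_eq_zero_of_natDegree_lt⟩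
  by_contra hne
  have hs : (SkewPolynomial.support (R := K) A).Nonempty :=
    Finset.nonempty_iff_ne_empty.2 fun h => hne (SkewPolynomial.support_eq_empty.1 h)
  obtain ⟨n, hn, hn'⟩ := Finset.exists_mem_eq_sup _ hs id
  have hd : A.natDegree = n := hn'
  rw [hd] at h0
  exact SkewPolynomial.mem_support_iff.1 hn h0

/-- The leading coefficient of a product is `a * σ^[m] b`, nonzero because `σ` is injective. -/
theorem eq_zero_of_mul_eq_zero {A U : SkewPoly σ} (hU : U ≠ 0) (h : A * U = 0) : A = 0 := by
  by_contra hA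
  obtain ⟨m, hm, hm'⟩ := exists_leading hA
  obtain ⟨n, hn, hn'⟩ := exists_leading hU
  have h1 : (A * U).coeff (m + n) = 0 := by rw [h, coeff_zero]
  rw [coeff_mul, Finset.sum_eq_single m, Nat.add_sub_cancel_left] at h1
  · exact hn (σ.injective.iterate m
      (((mul_eq_zero.1 h1).resolve_left hm).trans (iterate_map_zero σ m).symm))
  · intro i _ hi
    rcases lt_or_gt_of_ne hi with h | h
    · rw [hn' _ (by omega), iterate_map_zero, mul_zero]
    · rw [hm' _ h, zero_mul]
  · simp

theorem exists_eq_mul_add {P : SkewPoly σ} {d : ℕ} (hP : P.IsMonicOfDegree d) (A : SkewPoly σ) :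
    ∃ C R : SkewPoly σ, A = C * P + R ∧ ∀ i, d ≤ i → R.coeff i = 0 := by
  -- Induction on the excess `n` of the degree bound over `d`: subtracting `c X ^ n * P` removes the
  -- coefficient at `d + n`, since `σ` fixes the leading `1` of `P`.
  suffices h : ∀ n, ∀ A : SkewPoly σ, (∀ i, d + n ≤ i → A.coeff i = 0) →
      ∃ C R : SkewPoly σ, A = C * P + R ∧ ∀ i, d ≤ i → R.coeff i = 0 from
    h (A.natDegree + 1) A fun i hi => A.coeff_eq_zero_of_natDegree_lt (by omega)
  intro n
  induction n with
  | zero => exact fun A hA => ⟨0, A, by simp, hA⟩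
  | succ n ih =>
    intro A hA
    obtain ⟨C, R, h, hR⟩ := ih (A - monomial n (A.coeff (d + n)) * P) fun i hi => by
      rw [coeff_sub, coeff_mul]
      simp only [coeff_monomial, ite_mul, zero_mul]
      rw [Finset.sum_ite_eq, if_pos (Finset.mem_range.2 (by omega))]
      rcases hi.eq_or_lt with rfl | hi
      · rw [Nat.add_sub_cancel, hP.1, iterate_map_one, mul_one, sub_self]
      · rw [hP.2 _ (by omega), hA _ (by omega), iterate_map_zero, mul_zero, sub_zero]
    exact ⟨C + monomial n (A.coeff (d + n)), R, by
      rw [add_mul, add_right_comm, ← h, sub_add_cancel], hR⟩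

theorem exists_monic_mul {R : SkewPoly σ} (hR : R ≠ 0) {d : ℕ} (h : ∀ i, d ≤ i → R.coeff i = 0) :
    ∃ (C : SkewPoly σ) (n : ℕ), n < d ∧ (C * R).IsMonicOfDegree n := by
  obtain ⟨n, hn, hn'⟩ := exists_leading hR
  have hc (i : ℕ) : (monomial 0 (R.coeff n)⁻¹ * R).coeff i = (R.coeff n)⁻¹ * R.coeff i := by
    rw [coeff_mul]
    simp [coeff_monomial]
  refine ⟨monomial 0 (R.coeff n)⁻¹, n, not_le.1 fun hd => hn (h n hd), ?_, fun i hi => ?_⟩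
  · rw [hc, inv_mul_cancel₀ hn]
  · rw [hc, hn' i hi, mul_zero]

/-- Bézout's identity. -/
theorem exists_bezout {P U : SkewPoly σ} {d : ℕ} (hP : P.IsMonicOfDegree d) (h : IsRgcd 1 U P) :
    ∃ A B : SkewPoly σ, A * U + B * P = 1 := by
  classical
  -- A monic combination of least degree will be a common right-divisor; `P` itself shows that monic
  -- combinations exist.
  have hex : ∃ n, ∃ A B : SkewPoly σ, (A * U + B * P).IsMonicOfDegree n :=
    ⟨d, 0, 1, by simpa using hP⟩
  obtain ⟨A, B, hE⟩ := Nat.find_spec hex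
  have hdvd (A' B' : SkewPoly σ) : RightDvd (A * U + B * P) (A' * U + B' * P) := by
    obtain ⟨C, R, h, hR⟩ := exists_eq_mul_add hE (A' * U + B' * P)
    -- The remainder is again a combination of `U` and `P`; if nonzero, its monic multiple would
    -- contradict minimality.
    by_cases h0 : R = 0
    · exact ⟨C, by rw [h, h0, add_zero]⟩
    · obtain ⟨D, n, hn, hD⟩ := exists_monic_mul h0 hR
      refine absurd ⟨D * (A' - C * A), D * (B' - C * B), ?_⟩ (Nat.find_min hex hn)
      convert hD using 1
      rw [eq_sub_of_add_eq' h.symm]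
      noncomm_ring
  obtain ⟨C, hC⟩ := h.2.2 (A * U + B * P) (by simpa using hdvd 1 0) (by simpa using hdvd 0 1)
  exact ⟨C * A, C * B, by rw [hC]; noncomm_ring⟩

/-! ### Semilinear maps as modules over the skew polynomial ring -/

section Action

variable {V : Type*} [AddCommGroup V] [Module K V] (φ : V →ₛₗ[σ] V)

/-- The action of `K[X, σ]` on a space with a semilinear endomorphism `φ`, where `X` acts by `φ`. -/
def act (A : SkewPoly σ) (v : V) : V :=
  SkewPolynomial.sum (R := K) A fun i a => a • φ^[i] v

theorem act_monomial (n : ℕ) (c : K) (v : V) : act φ (monomial n c) v = c • φ^[n] v :=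
  SkewPolynomial.sum_monomial_index (by simp)

theorem act_one (v : V) : act φ (1 : SkewPoly σ) v = v := by
  rw [one_def, act_monomial, one_smul, Function.iterate_zero_apply]

theorem act_eq_sum {A : SkewPoly σ} {d : ℕ} (hA : ∀ i, d ≤ i → A.coeff i = 0) (v : V) :
    act φ A v = ∑ i ∈ Finset.range d, A.coeff i • φ^[i] v := by
  refine (SkewPolynomial.sum_def _ _).trans (Finset.sum_subset (fun i hi => ?_) fun i _ hi => ?_)
  · exact Finset.mem_range.2 (not_le.1 fun h => SkewPolynomial.mem_support_iff.1 hi (hA i h))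
  · have h0 := SkewPolynomial.notMem_support_iff.1 hi
    exact (congrArg (· • φ^[i] v) h0).trans (zero_smul _ _)

theorem act_zero (v : V) : act φ (0 : SkewPoly σ) v = 0 := by
  rw [act_eq_sum φ (d := 0) fun i _ => coeff_zero i, Finset.sum_range_zero]

theorem act_add (A B : SkewPoly σ) (v : V) : act φ (A + B) v = act φ A v + act φ B v := by
  have hA (i) (hi : A.natDegree + B.natDegree + 1 ≤ i) : A.coeff i = 0 :=
    A.coeff_eq_zero_of_natDegree_lt (by omega)
  have hB (i) (hi : A.natDegree + B.natDegree + 1 ≤ i) : B.coeff i = 0 :=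
    B.coeff_eq_zero_of_natDegree_lt (by omega)
  rw [act_eq_sum φ hA, act_eq_sum φ hB, act_eq_sum φ (d := A.natDegree + B.natDegree + 1)
    fun i hi => by rw [coeff_add, hA i hi, hB i hi, add_zero], ← Finset.sum_add_distrib]
  simp only [coeff_add, add_smul]

theorem act_sub (A B : SkewPoly σ) (v : V) : act φ (A - B) v = act φ A v - act φ B v := by
  rw [eq_sub_iff_add_eq, ← act_add, sub_add_cancel]

theorem act_vec_add (A : SkewPoly σ) (v w : V) : act φ A (v + w) = act φ A v + act φ A w := by
  induction A using monomial_add_induction with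
  | h0 => simp [act_zero]
  | hm n c => simp [act_monomial, iterate_map_add]
  | hadd A B hA hB => simp only [act_add, hA, hB]; abel

theorem act_vec_zero (A : SkewPoly σ) : act φ A (0 : V) = 0 := by
  simpa using act_vec_add φ A 0 0

theorem act_mul (A B : SkewPoly σ) (v : V) : act φ (A * B) v = act φ A (act φ B v) := by
  induction A using monomial_add_induction with
  | h0 => simp [act_zero]
  | hadd A₁ A₂ h₁ h₂ => simp [add_mul, act_add, h₁, h₂]
  | hm m c =>
    induction B using monomial_add_induction with
    | h0 => simp [act_zero, act_vec_zero]
    | hadd B₁ B₂ h₁ h₂ => simp [mul_add, act_add, act_vec_add, h₁, h₂]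
    | hm k b =>
      rw [monomial_mul_monomial]
      simp only [act_monomial]
      rw [semilinear_iterate_smul, Function.iterate_add_apply, mul_smul]

theorem act_intertwine {W : Type*} [AddCommGroup W] [Module K W] {ψ : W →ₛₗ[σ] W}
    {f : V →ₗ[K] W} (h : ∀ x, f (φ x) = ψ (f x)) (A : SkewPoly σ) (v : V) :
    f (act φ A v) = act ψ A (f v) := by
  induction A using monomial_add_induction with
  | h0 => simp [act_zero]
  | hadd A₁ A₂ h₁ h₂ => simp [act_add, h₁, h₂]
  | hm m c => rw [act_monomial, act_monomial, map_smul, intertwiner_iterate h]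

end Action

/-- The semilinear map `v ↦ G * σ(v)`. -/
def matrixSemilinear (σ : K →+* K) {d : ℕ} (G : Matrix (Fin d) (Fin d) K) :
    (Fin d → K) →ₛₗ[σ] (Fin d → K) where
  toFun v := G.mulVec (σ ∘ v)
  map_add' v w := by
    rw [← Matrix.mulVec_add]
    congr 1
    ext i
    simp
  map_smul' c v := by
    rw [← Matrix.mulVec_smul]
    congr 1
    ext i
    simp

theorem matrixSemilinear_iterate {d : ℕ} (G : Matrix (Fin d) (Fin d) K) (r : ℕ) (v : Fin d → K) :
    (matrixSemilinear σ G)^[r] v = (sigmaNorm σ r G).mulVec (σ^[r] ∘ v) := by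
  induction r generalizing v with
  | zero => simp [sigmaNorm]
  | succ r ih =>
    have h : sigmaNorm σ (r + 1) G = sigmaNorm σ r G * G.map σ^[r] := by
      simp only [sigmaNorm, List.range_succ, List.map_append, List.prod_append, List.map_singleton,
        List.prod_singleton]
    rw [Function.iterate_succ_apply, ih, h, ← Matrix.mulVec_mulVec]
    congr 1
    ext i
    simp only [matrixSemilinear, Matrix.mulVec, dotProduct, LinearMap.coe_mk, AddHom.coe_mk,
      Function.comp_apply, Matrix.map_apply, ringHom_iterate_sum, iterate_map_mul,
      Function.iterate_succ_apply]

/-! ### The companion map as a model of the cyclic module of `P` -/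

section Companion

variable (P : SkewPoly σ)

/-- The `n`-th vector of the standard basis of `K ^ d` (zero if `d ≤ n`). -/
def stdVec (K : Type*) [Field K] (d n : ℕ) : Fin d → K := fun i => if (i : ℕ) = n then 1 else 0

/-- Multiplication by `X` on `K[X, σ] / K[X, σ] P`. -/
def companionMap : (Fin P.natDegree → K) →ₛₗ[σ] (Fin P.natDegree → K) :=
  matrixSemilinear σ P.companion

theorem companionMap_stdVec {n : ℕ} (hn : n < P.natDegree) (i : Fin P.natDegree) :
    P.companionMap (stdVec K P.natDegree n) i =
      if n + 1 = P.natDegree then -P.coeff i else stdVec K P.natDegree (n + 1) i := by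
  change ∑ j, P.companion i j * σ (if (j : ℕ) = n then 1 else 0) = _
  rw [Finset.sum_eq_single ⟨n, hn⟩]
  · simp [companion, stdVec]
  · intro j _ hj
    rw [if_neg fun h => hj (Fin.ext h), map_zero, mul_zero]
  · simp

theorem companionMap_iterate {n : ℕ} (hn : n < P.natDegree) :
    P.companionMap^[n] (stdVec K P.natDegree 0) = stdVec K P.natDegree n := by
  induction n with
  | zero => rfl
  | succ n ih =>
    rw [Function.iterate_succ_apply', ih (by omega)]
    ext i
    rw [companionMap_stdVec P (by omega), if_neg hn.ne]

theorem companionMap_iterate_natDegree (i : Fin P.natDegree) :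
    P.companionMap^[P.natDegree] (stdVec K P.natDegree 0) i = -P.coeff i := by
  obtain ⟨n, hn⟩ := Nat.exists_eq_succ_of_ne_zero (n := P.natDegree) (by have := i.isLt; omega)
  have h : P.companionMap^[n + 1] (stdVec K P.natDegree 0) i = -P.coeff i := by
    rw [Function.iterate_succ_apply', companionMap_iterate P (by omega),
      companionMap_stdVec P (by omega), if_pos hn.symm]
  rwa [← Nat.succ_eq_add_one, ← hn] at h

theorem sum_smul_companionMap_iterate (a : ℕ → K) :
    ∑ j ∈ Finset.range P.natDegree, a j • P.companionMap^[j] (stdVec K P.natDegree 0) =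
      fun i : Fin P.natDegree => a i := by
  ext i
  rw [Finset.sum_congr rfl fun j hj => by rw [companionMap_iterate P (Finset.mem_range.1 hj)]]
  simp [Finset.sum_apply, stdVec]

theorem act_companionMap_of_coeff {R : SkewPoly σ} (hR : ∀ i, P.natDegree ≤ i → R.coeff i = 0) :
    act P.companionMap R (stdVec K P.natDegree 0) =
      fun i : Fin P.natDegree => R.coeff i := by
  rw [act_eq_sum _ hR, sum_smul_companionMap_iterate]

variable {P}

theorem act_companionMap_self (hP : P.Monic) :
    act P.companionMap P (stdVec K P.natDegree 0) = 0 := by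
  rw [act_eq_sum (d := P.natDegree + 1) _ fun i hi => P.coeff_eq_zero_of_natDegree_lt hi,
    Finset.sum_range_succ, sum_smul_companionMap_iterate, hP, one_smul]
  ext i
  rw [Pi.add_apply, companionMap_iterate_natDegree, add_neg_cancel, Pi.zero_apply]

/-- `stdVec K P.natDegree 0` plays the class of `1`. A remainder modulo `P` acts on it by listing
its coefficients, so it annihilates the vector only when it is zero. -/
theorem act_companionMap_eq_zero_iff (hP : P.Monic) (A : SkewPoly σ) :
    act P.companionMap A (stdVec K P.natDegree 0) = 0 ↔ RightDvd P A := by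
  constructor
  · intro h
    obtain ⟨C, R, rfl, hR⟩ := exists_eq_mul_add hP.isMonicOfDegree A
    rw [act_add, act_mul, act_companionMap_self hP, act_vec_zero, zero_add,
      act_companionMap_of_coeff P hR] at h
    refine ⟨C, ?_⟩
    have : R = 0 := ext_coeff fun n => by
      by_cases hn : n < P.natDegree
      · exact congrFun h ⟨n, hn⟩
      · exact hR n (not_lt.1 hn)
    rw [this, add_zero]
  · rintro ⟨C, rfl⟩
    rw [act_mul, act_companionMap_self hP, act_vec_zero]

variable (P)

theorem exists_act_companionMap (x : Fin P.natDegree → K) :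
    ∃ A : SkewPoly σ, act P.companionMap A (stdVec K P.natDegree 0) = x := by
  let F : SkewPoly σ →+ (Fin P.natDegree → K) :=
    { toFun := fun A => act P.companionMap A (stdVec K P.natDegree 0)
      map_zero' := act_zero _ _
      map_add' := fun A B => act_add _ A B _ }
  refine ⟨∑ i : Fin P.natDegree, monomial i (x i), ?_⟩
  change F _ = x
  rw [map_sum]
  change ∑ i : Fin P.natDegree, act P.companionMap (monomial i (x i)) _ = x
  simp only [act_monomial]
  ext i
  simp [companionMap_iterate, Finset.sum_apply, stdVec, Fin.val_inj]

theorem span_companionMap_iterate :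
    Submodule.span K (Set.range fun n => P.companionMap^[n] (stdVec K P.natDegree 0)) = ⊤ := by
  rw [eq_top_iff]
  rintro x -
  obtain ⟨A, rfl⟩ := exists_act_companionMap P x
  rw [act_eq_sum (d := A.natDegree + 1) _ fun i hi => A.coeff_eq_zero_of_natDegree_lt hi]
  exact Submodule.sum_mem _ fun i _ =>
    Submodule.smul_mem _ _ (Submodule.subset_span ⟨i, rfl⟩)

end Companion

/-! ### Similarity as isomorphism of cyclic modules -/

variable {P Q : SkewPoly σ}

/-- `U` represents the image of the class of `1`, so `h` is right multiplication by `U`.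
Surjectivity of `h` gives coprimality of `U` and `P`, and injectivity gives minimality of `Q * U`.
-/
theorem similar_of_equiv (hP : P.Monic) (hQ : Q.Monic)
    (h : (Fin Q.natDegree → K) ≃ₗ[K] (Fin P.natDegree → K))
    (hh : ∀ x, h (Q.companionMap x) = P.companionMap (h x)) : Similar P Q := by
  obtain ⟨U, hU0, hU⟩ : ∃ U : SkewPoly σ, U ≠ 0 ∧
      act P.companionMap U (stdVec K P.natDegree 0) = h (stdVec K Q.natDegree 0) := by
    obtain ⟨U, hU⟩ := exists_act_companionMap P (h (stdVec K Q.natDegree 0))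
    -- Similarity demands `U ≠ 0`; should the representative be zero, the nonzero `P` represents the
    -- same class.
    by_cases h0 : U = 0
    · refine ⟨P, ?_, ?_⟩
      · rintro rfl
        exact zero_ne_one (α := K) hP
      · rw [act_companionMap_self hP, ← hU, h0, act_zero]
    · exact ⟨U, h0, hU⟩
  have key (A : SkewPoly σ) : act P.companionMap (A * U) (stdVec K P.natDegree 0) =
      h (act Q.companionMap A (stdVec K Q.natDegree 0)) := by
    rw [act_mul, hU]
    exact (act_intertwine Q.companionMap (f := h.toLinearMap) hh A _).symm
  refine ⟨U, hU0, ⟨⟨U, by simp⟩, ⟨P, by simp⟩, ?_⟩, ⟨Q, rfl⟩, ?_, ?_⟩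
  · rintro E ⟨B, hB⟩ ⟨C, hC⟩
    obtain ⟨A, hA⟩ := exists_act_companionMap Q (h.symm (stdVec K P.natDegree 0))
    have h1 : RightDvd P (A * U - 1) := by
      rw [← act_companionMap_eq_zero_iff hP, act_sub, key, hA, act_one, h.apply_symm_apply, sub_self]
    obtain ⟨D, hD⟩ := h1
    refine ⟨A * B - D * C, ?_⟩
    rw [sub_mul, mul_assoc, mul_assoc, ← hB, ← hC, ← hD, sub_sub_cancel]
  · rw [← act_companionMap_eq_zero_iff hP, key, act_companionMap_self hQ, map_zero]
  · rintro N ⟨A, rfl⟩ hN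
    rw [← act_companionMap_eq_zero_iff hP, key, h.map_eq_zero_iff,
      act_companionMap_eq_zero_iff hQ] at hN
    obtain ⟨C, rfl⟩ := hN
    exact ⟨C, mul_assoc _ _ _⟩

/-- The map sends the class of `A` to that of `A * U`. It is well defined because `P` right-divides
`Q * U`, injective by minimality of the multiple `Q * U`, and surjective by Bézout. -/
theorem Similar.exists_equiv (hP : P.Monic) (hQ : Q.Monic) (hs : Similar P Q) :
    ∃ h : (Fin Q.natDegree → K) ≃ₗ[K] (Fin P.natDegree → K),
      ∀ x, h (Q.companionMap x) = P.companionMap (h x) := by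
  obtain ⟨U, hU0, hgcd, hlcm⟩ := hs
  set u := act P.companionMap U (stdVec K P.natDegree 0) with hu
  have hQu : act P.companionMap Q u = 0 := by
    rw [hu, ← act_mul, act_companionMap_eq_zero_iff hP]
    exact hlcm.2.1
  let f : (Fin Q.natDegree → K) →ₗ[K] (Fin P.natDegree → K) :=
    Fintype.linearCombination K fun i : Fin Q.natDegree => P.companionMap^[i] u
  have hf (A : SkewPoly σ) : f (act Q.companionMap A (stdVec K Q.natDegree 0)) =
      act P.companionMap A u := by
    obtain ⟨C, R, rfl, hR⟩ := exists_eq_mul_add hQ.isMonicOfDegree A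
    rw [act_add, act_add, act_mul, act_mul, hQu, act_companionMap_self hQ, act_vec_zero,
      act_vec_zero, zero_add, zero_add, act_companionMap_of_coeff Q hR, act_eq_sum _ hR,
      Finset.sum_range]
    rfl
  have hcomm (x) : f (Q.companionMap x) = P.companionMap (f x) := by
    obtain ⟨A, rfl⟩ := exists_act_companionMap Q x
    have h1 {W : Type _} [AddCommGroup W] [Module K W] (φ : W →ₛₗ[σ] W) (v : W) :
        φ (act φ A v) = act φ (monomial 1 1 * A) v := by
      rw [act_mul, act_monomial, one_smul, Function.iterate_one]
    rw [h1, hf, hf, h1]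
  have hinj : Function.Injective f := by
    rw [injective_iff_map_eq_zero]
    intro x hx
    obtain ⟨A, rfl⟩ := exists_act_companionMap Q x
    rw [hf, hu, ← act_mul, act_companionMap_eq_zero_iff hP] at hx
    obtain ⟨C, hC⟩ := hlcm.2.2 (A * U) ⟨A, rfl⟩ hx
    rw [act_companionMap_eq_zero_iff hQ]
    refine ⟨C, sub_eq_zero.1 (eq_zero_of_mul_eq_zero hU0 ?_)⟩
    rw [sub_mul, hC, mul_assoc, sub_self]
  have hsurj : Function.Surjective f := by
    obtain ⟨A, B, hAB⟩ := exists_bezout hP.isMonicOfDegree hgcd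
    intro y
    obtain ⟨C, rfl⟩ := exists_act_companionMap P y
    refine ⟨act Q.companionMap (C * A) (stdVec K Q.natDegree 0), ?_⟩
    rw [hf, act_mul, hu, ← act_mul _ A, eq_sub_of_add_eq hAB, act_sub, act_one, act_mul _ B,
      act_companionMap_self hP, act_vec_zero, sub_zero]
  exact ⟨LinearEquiv.ofBijective f ⟨hinj, hsurj⟩, hcomm⟩

end SkewPoly

/-! ### Conjugate matrices, Frobenius, and the main theorem -/

theorem matrixConj_iff_exists_equiv {K : Type*} [Field K] {m n : ℕ}
    (A : Matrix (Fin m) (Fin m) K) (B : Matrix (Fin n) (Fin n) K) :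
    MatrixConj A B ↔ ∃ g : (Fin m → K) ≃ₗ[K] (Fin n → K),
      ∀ x, g (A.mulVec x) = B.mulVec (g x) := by
  constructor
  · rintro ⟨rfl, c, hc⟩
    replace hc : c.1 * A = B * c.1 := hc
    refine ⟨LinearEquiv.ofLinearMap (Matrix.toLin' c.1) (Matrix.toLin' c⁻¹.1)
      (by rw [← Matrix.toLin'_mul, Units.mul_inv, Matrix.toLin'_one])
      (by rw [← Matrix.toLin'_mul, Units.inv_mul, Matrix.toLin'_one]), fun x => ?_⟩
    simp only [LinearEquiv.coe_ofLinearMap, Matrix.toLin'_apply, Matrix.mulVec_mulVec, hc]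
  · rintro ⟨g, hg⟩
    obtain rfl : m = n := by simpa using g.finrank_eq
    refine ⟨rfl, ⟨⟨LinearMap.toMatrix' g.toLinearMap, LinearMap.toMatrix' g.symm.toLinearMap,
      by rw [← LinearMap.toMatrix'_comp]; simp, by rw [← LinearMap.toMatrix'_comp]; simp⟩, ?_⟩⟩
    change LinearMap.toMatrix' g.toLinearMap * A = B * LinearMap.toMatrix' g.toLinearMap
    apply Matrix.toLin'.injective
    refine LinearMap.ext fun x => ?_
    simp [Matrix.toLin'_mul, hg]

/-- A generator of the unit group of `𝔽_{q ^ r}` has `r` distinct conjugates over `𝔽_q`. -/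
theorem exists_iterateFrobenius_injective {K : Type*} [Field K] (p a r : ℕ) [Fact p.Prime]
    [CharP K p] (ha : 1 ≤ a) (hr : 1 ≤ r) (hK : Nat.card K = (p ^ a) ^ r) :
    ∃ ζ : K, Function.Injective fun i : Fin r => (iterateFrobenius K p a)^[i] ζ := by
  have hp := (Fact.out : p.Prime)
  have hq : 2 ≤ p ^ a := hp.two_le.trans (Nat.le_self_pow (by omega) p)
  have : Finite K := Nat.finite_of_card_ne_zero (by rw [hK]; positivity)
  obtain ⟨ζ, hζ⟩ := IsCyclic.exists_ofOrder_eq_natCard (α := Kˣ)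
  rw [Nat.card_units, hK] at hζ
  have hpow (i : ℕ) : (iterateFrobenius K p a)^[i] (ζ : K) = ((ζ ^ (p ^ a) ^ i : Kˣ) : K) := by
    induction i with
    | zero => simp
    | succ i ih =>
      rw [Function.iterate_succ_apply', ih, iterateFrobenius_def, pow_succ, pow_mul]
      simp
  refine ⟨ζ, fun i j hij => ?_⟩
  -- The case `r = 1` is separate because the bound below fails for `𝔽₂`, whose unit group has order
  -- `1`.
  rcases hr.eq_or_lt with rfl | hr
  · exact Subsingleton.elim i j
  have hlt (i : Fin r) : (p ^ a) ^ (i : ℕ) < orderOf ζ := by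
    have h1 : (p ^ a) ^ (i : ℕ) ≤ (p ^ a) ^ (r - 1) :=
      Nat.pow_le_pow_right (by omega) (by omega)
    have h2 : (p ^ a) ^ r = (p ^ a) ^ (r - 1) * p ^ a := by
      rw [← pow_succ, Nat.sub_add_cancel hr.le]
    have h3 : 2 ≤ (p ^ a) ^ (r - 1) := hq.trans (Nat.le_self_pow (by omega) _)
    rw [hζ, h2]
    -- With `q = p ^ a`, `q ^ r ≥ 2 q ^ (r-1)` and `q ^ (r-1) ≥ 2` give `q ^ (r-1) < q ^ r - 1`, the
    -- order of `ζ`.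
    have h4 := Nat.mul_le_mul_left ((p ^ a) ^ (r - 1)) hq
    omega
  simp only [hpow] at hij
  exact Fin.ext (Nat.pow_right_injective hq (pow_injOn_Iio_orderOf (hlt i) (hlt j) (Units.ext hij)))

theorem iterateFrobenius_iterate_eq {K : Type*} [Field K] (p a r : ℕ) [Fact p.Prime]
    [CharP K p] (hK : Nat.card K = (p ^ a) ^ r) (x : K) : (iterateFrobenius K p a)^[r] x = x := by
  have hp := (Fact.out : p.Prime)
  have : Finite K := Nat.finite_of_card_ne_zero (by rw [hK]; have := hp.pos; positivity)
  have := Fintype.ofFinite K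
  have hpow (i : ℕ) : (iterateFrobenius K p a)^[i] x = x ^ (p ^ a) ^ i := by
    induction i with
    | zero => simp
    | succ i ih => rw [Function.iterate_succ_apply', ih, iterateFrobenius_def, pow_succ, pow_mul]
  rw [hpow, ← hK, Nat.card_eq_fintype_card, FiniteField.pow_card]

theorem mainTheorem8 {K : Type*} [Field K] (p a r : ℕ) [Fact p.Prime] [CharP K p]
    (ha : 1 ≤ a) (hr : 1 ≤ r) (hK : Nat.card K = (p ^ a) ^ r)
    (P Q : SkewPoly (iterateFrobenius K p a)) (hP : P.Monic) (hQ : Q.Monic) :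
    SkewPoly.Similar P Q ↔
      MatrixConj (sigmaNorm (iterateFrobenius K p a) r P.companion)
        (sigmaNorm (iterateFrobenius K p a) r Q.companion) := by
  have hp := (Fact.out : p.Prime)
  have : Finite K := Nat.finite_of_card_ne_zero (by rw [hK]; have := hp.pos; positivity)
  have hσ := iterateFrobenius_iterate_eq (K := K) p a r hK
  have hnorm (R : SkewPoly (iterateFrobenius K p a)) (x) : R.companionMap^[r] x =
      (sigmaNorm (iterateFrobenius K p a) r R.companion).mulVec x := by
    refine (SkewPoly.matrixSemilinear_iterate _ r x).trans (congrArg _ (funext fun i => hσ _))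
  rw [matrixConj_iff_exists_equiv]
  simp only [← hnorm]
  constructor
  · intro h
    obtain ⟨f, hf⟩ := h.exists_equiv hP hQ
    refine ⟨f.symm, fun x => f.injective ?_⟩
    rw [f.apply_symm_apply]
    refine ((intertwiner_iterate (f := f.toLinearMap) hf r _).trans ?_).symm
    rw [LinearEquiv.coe_coe, f.apply_symm_apply]
  · rintro ⟨g, hg⟩
    obtain ⟨ζ, hζ⟩ := exists_iterateFrobenius_injective (K := K) p a r ha hr hK
    obtain ⟨h, hh⟩ := exists_intertwining_equiv hr P.companionMap Q.companionMap ζ hζ hσ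
      P.span_companionMap_iterate Q.span_companionMap_iterate g hg
    refine SkewPoly.similar_of_equiv hP hQ h.symm fun x => h.injective ?_
    rw [hh, h.apply_symm_apply, h.apply_symm_apply]
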